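/- Let $n\ge 0$ and equip $\mathbb R^n$ with its Euclidean structure. A polyhedral convex cone in $\mathbb R^n$ is a set of the form $\{x : \langle a_j,x\rangle\ge 0,\ j=1,\dots,m\}$ with $m\ge 0$ and $a_1,\dots,a_m\in\mathbb R^n$. A Motzkin set is a closed set of the form $K+D$ with $K\subset\mathbb R^n$ compact and $D\subset\mathbb R^n$ a closed convex cone containing $0$. A set $F\subset\mathbb R^n$ is an FW-set (Frank-and-Wolfe set) if every quadratic function $f(x)=\tfrac12 x^{\mathsf T}Ax+b^{\mathsf T}x+c$ (with $A=A^{\mathsf T}\in\mathbb R^{n\times n}$, $b\in\mathbb R^n$, $c\in\mathbb R$) that is bounded below on $F$ attains its infimum at a point of $F$. Let $(F_i)_{i\in I}$ be a finite family of subsets of $\mathbb R^n$. (a) If every $F_i$ is of the form $K_i+D_i$ with $K_i$ compact (possibly empty) and $D_i$ a polyhedral convex cone, then $\bigcap_{i\in I}F_i$ is again of the form $K+D$ with $K$ compact (possibly empty) and $D$ a polyhedral convex cone. (b) If every $F_i$ is a Motzkin set and an FW-set, and $\bigcap_{i\in I}F_i$ is nonempty, then $\bigcap_{i\in I}F_i$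 is a Motzkin set and an FW-set. -/

import Mathlib

open scoped Pointwise

namespace FrankWolfe

/-- A polyhedral convex cone: the solution set of a finite system of homogeneous weak linear
inequalities `0 ≤ ⟪a, x⟫`, with `a` in a finite set. -/
def IsPolyhedralCone {E : Type*} [NormedAddCommGroup E] [InnerProductSpace ℝ E]
    (D : PointedCone ℝ E) : Prop :=
  D.DualFG (innerₗ E)

/-- The sets `K + D` (Minkowski sum) with `K` compact and `D` a polyhedral convex cone. -/
def IsCompactAddPolyhedralCone {E : Type*} [NormedAddCommGroup E] [InnerProductSpace ℝ E]
    (F : Set E) : Prop :=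
  ∃ (K : Set E) (D : PointedCone ℝ E),
    IsCompact K ∧ IsPolyhedralCone D ∧ F = K + (D : Set E)

/-- A Motzkin set: a closed set `K + D` with `K` compact and `D` a closed convex cone. -/
def IsMotzkin {E : Type*} [NormedAddCommGroup E] [InnerProductSpace ℝ E]
    (F : Set E) : Prop :=
  IsClosed F ∧ ∃ (K : Set E) (D : PointedCone ℝ E),
    IsCompact K ∧ IsClosed (D : Set E) ∧ F = K + (D : Set E)

/-- A quadratic function `x ↦ (1/2) xᵀ A x + bᵀ x + c` on `ℝⁿ`, with `A` symmetric
(`A = 0` is allowed). -/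
def IsQuadratic {n : ℕ} (f : EuclideanSpace ℝ (Fin n) → ℝ) : Prop :=
  ∃ (A : Matrix (Fin n) (Fin n) ℝ) (b : Fin n → ℝ) (c : ℝ), A.IsSymm ∧
    ∀ x, f x = (1 / 2 : ℝ) * (x.ofLp ⬝ᵥ A.mulVec x.ofLp) + b ⬝ᵥ x.ofLp + c

/-- A Frank-and-Wolfe set: every quadratic function that is bounded below on `F` attains its
infimum on `F`. -/
def IsFW {n : ℕ} (F : Set (EuclideanSpace ℝ (Fin n))) : Prop :=
  ∀ f : EuclideanSpace ℝ (Fin n) → ℝ, IsQuadratic f → BddBelow (f '' F) →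
    ∃ x ∈ F, IsMinOn f F x

/-- A Motzkin FW-set. -/
def IsFWM {n : ℕ} (F : Set (EuclideanSpace ℝ (Fin n))) : Prop :=
  IsMotzkin F ∧ IsFW F

end FrankWolfe

open Filter Topology Set

namespace FrankWolfe

/-! Both parts rest on retractability of the recession cone: near `v ∈ D`, one can step back by `v /
2` inside `D`. Polyhedral cones have it, and it passes to intersections. Its use is a shortening
argument. If cone elements chosen of least norm were unbounded, their normalised limit `v` would lie
in the cone, and subtracting a multiple of `v` would give a shorter admissible element. This yields
`K + D` forms for intersections (`exists_inter_eq_add_inf`) and the Frank-Wolfe property of `K + D`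
(`exists_isMinOn_add_of_isRetractable`). For (b), an FW-set `K + D` has retractable `D`: attaining
the distance to affine subspaces makes `K + D + W` closed for every subspace `W`; cancelling `K`,
each `D + W` is closed; Mirkil's theorem makes `D` finitely generated, hence retractable. -/

/-- A closed cone `D` is retractable if every point of `D` close to `v ∈ D` stays in `D` after
moving it by `-v / 2`. Polyhedral cones have this property. -/
structure IsRetractable {E : Type*} [NormedAddCommGroup E] [NormedSpace ℝ E]
    (D : PointedCone ℝ E) : Prop where
  isClosed : IsClosed (D : Set E)
  eventually_sub_mem : ∀ v ∈ D, ∀ᶠ x in 𝓝 v, x ∈ D → x - (1 / 2 : ℝ) • v ∈ D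

/-! ### Retractable cones and shortening -/

section Retractable

variable {E : Type*} [NormedAddCommGroup E] [NormedSpace ℝ E]

theorem IsRetractable.top : IsRetractable (⊤ : PointedCone ℝ E) :=
  ⟨isClosed_univ, fun _ _ => Eventually.of_forall fun _ _ => trivial⟩

theorem IsRetractable.inf {D₁ D₂ : PointedCone ℝ E} (h₁ : IsRetractable D₁)
    (h₂ : IsRetractable D₂) : IsRetractable (D₁ ⊓ D₂) := by
  refine ⟨h₁.isClosed.inter h₂.isClosed, fun v hv => ?_⟩
  filter_upwards [h₁.eventually_sub_mem v hv.1, h₂.eventually_sub_mem v hv.2] with x hx₁ hx₂ hx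
  exact ⟨hx₁ hx.1, hx₂ hx.2⟩

/-- Constraints vanishing at `v` do not notice the shift; those positive at `v` stay positive near
`v / 2`. -/
theorem isRetractable_of_forall_nonneg {κ : Type*} [Finite κ] {D : PointedCone ℝ E}
    (a : κ → E →L[ℝ] ℝ) (hD : ∀ x, x ∈ D ↔ ∀ j, 0 ≤ a j x) : IsRetractable D := by
  have hset : (D : Set E) = ⋂ j, {x | 0 ≤ a j x} := by
    ext x; simp [hD]
  refine ⟨?_, fun v hv => ?_⟩
  · rw [hset]
    exact isClosed_iInter fun j => isClosed_le continuous_const (a j).continuous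
  · have key : ∀ᶠ x in 𝓝 v, ∀ j, 0 ≤ a j x → 0 ≤ a j (x - (1 / 2 : ℝ) • v) := by
      refine eventually_all.2 fun j => ?_
      rcases ((hD v).1 hv j).eq_or_lt with h0 | hpos
      · refine Eventually.of_forall fun x hx => ?_
        simpa [← h0] using hx
      · have : ∀ᶠ x in 𝓝 v, 0 < a j (x - (1 / 2 : ℝ) • v) := by
          refine ((a j).continuous.comp (continuous_id.sub continuous_const)).continuousAt.eventually
            (lt_mem_nhds ?_)
          simp
          linarith
        exact this.mono fun x hx _ => hx.le
    exact key.mono fun x hx hxD => (hD _).2 fun j => hx j ((hD x).1 hxD j)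

/-- Homogeneity turns the local condition at `v` into one on arbitrarily long vectors of asymptotic
direction `v`. -/
theorem IsRetractable.of_tendsto {D : PointedCone ℝ E} (hD : IsRetractable D) {e : ℕ → E}
    {r : ℕ → ℝ} {v : E} (he : ∀ m, e m ∈ D) (hr : ∀ m, 0 < r m)
    (hv : Tendsto (fun m => (r m)⁻¹ • e m) atTop (𝓝 v)) :
    v ∈ D ∧ ∀ᶠ m in atTop, e m - (r m / 2) • v ∈ D := by
  have hmem : ∀ m, (r m)⁻¹ • e m ∈ D := fun m => D.smul_mem (inv_nonneg.2 (hr m).le) (he m)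
  have hvD : v ∈ D := hD.isClosed.mem_of_tendsto hv (Eventually.of_forall hmem)
  refine ⟨hvD, (hv.eventually (hD.eventually_sub_mem v hvD)).mono fun m hm => ?_⟩
  have := D.smul_mem (hr m).le (hm (hmem m))
  rwa [smul_sub, smul_smul, smul_smul, mul_inv_cancel₀ (hr m).ne', one_smul, mul_one_div] at this

/-- Along a subsequence, nonzero elements of a retractable cone can be shortened inside the cone by
subtracting multiples of a fixed unit vector of the cone. -/
theorem IsRetractable.exists_shorten [FiniteDimensional ℝ E] {D : PointedCone ℝ E}
    (hD : IsRetractable D) {d : ℕ → E} (hd : ∀ m, d m ∈ D) (h0 : ∀ m, d m ≠ 0) :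
    ∃ v ∈ D, ‖v‖ = 1 ∧ ∃ φ : ℕ → ℕ, StrictMono φ ∧
      Tendsto (fun m => ‖d (φ m)‖⁻¹ • d (φ m)) atTop (𝓝 v) ∧
      ∀ᶠ m in atTop, d (φ m) - (‖d (φ m)‖ / 2) • v ∈ D ∧
        ‖d (φ m) - (‖d (φ m)‖ / 2) • v‖ < ‖d (φ m)‖ := by
  have hpos : ∀ m, 0 < ‖d m‖ := fun m => norm_pos_iff.2 (h0 m)
  obtain ⟨v, hv, φ, hφ, hlim⟩ := (isCompact_sphere (0 : E) 1).tendsto_subseq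
    (x := fun m => ‖d m‖⁻¹ • d m) (fun m => by
      simp [norm_smul, (hpos m).ne'])
  have hv1 : ‖v‖ = 1 := by simpa using hv
  obtain ⟨hvD, hev⟩ := hD.of_tendsto (fun m => hd (φ m)) (fun m => hpos (φ m)) hlim
  refine ⟨v, hvD, hv1, φ, hφ, hlim, hev.and ?_⟩
  have hlt : ∀ᶠ m in atTop, ‖‖d (φ m)‖⁻¹ • d (φ m) - (1 / 2 : ℝ) • v‖ < 1 := by
    have hl : Tendsto (fun m => ‖‖d (φ m)‖⁻¹ • d (φ m) - (1 / 2 : ℝ) • v‖) atTop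
        (𝓝 ‖v - (1 / 2 : ℝ) • v‖) := (hlim.sub_const _).norm
    refine hl.eventually (gt_mem_nhds ?_)
    have : v - (1 / 2 : ℝ) • v = (1 / 2 : ℝ) • v := by module
    rw [this, norm_smul, hv1]
    norm_num
  refine hlt.mono fun m hm => ?_
  have hp := hpos (φ m)
  have : d (φ m) - (‖d (φ m)‖ / 2) • v =
      ‖d (φ m)‖ • (‖d (φ m)‖⁻¹ • d (φ m) - (1 / 2 : ℝ) • v) := by
    rw [smul_sub, smul_smul, smul_smul, mul_inv_cancel₀ hp.ne', one_smul, mul_one_div]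
  rw [this, norm_smul, norm_norm]
  exact mul_lt_of_lt_one_right hp hm

theorem exists_norm_minimal [FiniteDimensional ℝ E] {Z : Set E} (hZ : IsClosed Z)
    (hne : Z.Nonempty) : ∃ z ∈ Z, ∀ y ∈ Z, ‖z‖ ≤ ‖y‖ := by
  obtain ⟨z, hz, h⟩ := hZ.exists_infDist_eq_dist hne 0
  refine ⟨z, hz, fun y hy => ?_⟩
  have := Metric.infDist_le_dist_of_mem (x := (0 : E)) hy
  rwa [h, dist_zero_left, dist_zero_left] at this

/-- Linear maps restricted to a retractable cone admit preimages of linearly bounded norm. -/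
theorem IsRetractable.exists_bounded_lift [FiniteDimensional ℝ E] {E' : Type*}
    [NormedAddCommGroup E'] [NormedSpace ℝ E'] {D : PointedCone ℝ E} (hD : IsRetractable D)
    (f : E →L[ℝ] E') :
    ∃ C : ℝ, ∀ d ∈ D, ∃ d' ∈ D, f d' = f d ∧ ‖d'‖ ≤ C * ‖f d‖ := by
  -- Otherwise take elements of least norm in their fibres with `‖d m‖ > m * ‖f (d m)‖`. The limit
  -- direction lies in the kernel, so shortening stays in the fibre.
  by_contra! hcon
  have hstep : ∀ m : ℕ, ∃ d ∈ D, (m : ℝ) * ‖f d‖ < ‖d‖ ∧ ∀ y ∈ D, f y = f d → ‖d‖ ≤ ‖y‖ := by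
    intro m
    obtain ⟨d, hd, hlt⟩ := hcon m
    obtain ⟨z, ⟨hz, hfz⟩, hmin⟩ := exists_norm_minimal (Z := (D : Set E) ∩ f ⁻¹' {f d})
      (hD.isClosed.inter (isClosed_singleton.preimage f.continuous)) ⟨d, hd, rfl⟩
    have hfz : f z = f d := hfz
    exact ⟨z, hz, hfz ▸ hlt z hz hfz, fun y hy hfy => hmin y ⟨hy, hfy.trans hfz⟩⟩
  choose d hd hlt hmin using hstep
  have h0 : ∀ m, d m ≠ 0 := fun m h => by simpa [h] using hlt m
  obtain ⟨v, hv, hv1, φ, hφ, hlim, hev⟩ := hD.exists_shorten hd h0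
  have hfv : f v = 0 := by
    have h1 : Tendsto (fun m => f (‖d (φ m)‖⁻¹ • d (φ m))) atTop (𝓝 (f v)) :=
      (f.continuous.tendsto v).comp hlim
    have h2 : Tendsto (fun m => f (‖d (φ m)‖⁻¹ • d (φ m))) atTop (𝓝 0) := by
      have hφ' : Tendsto (fun m => ((φ m : ℕ) : ℝ)⁻¹) atTop (𝓝 0) :=
        tendsto_inv_atTop_zero.comp (tendsto_natCast_atTop_atTop.comp hφ.tendsto_atTop)
      refine squeeze_zero_norm' ?_ hφ'
      filter_upwards [hφ.tendsto_atTop.eventually_gt_atTop 0] with m hm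
      have hm' : (0 : ℝ) < (φ m : ℝ) := by exact_mod_cast hm
      have hp : 0 < ‖d (φ m)‖ := norm_pos_iff.2 (h0 _)
      rw [map_smul, norm_smul, norm_inv, norm_norm, inv_mul_le_iff₀ hp, ← div_eq_mul_inv,
        le_div_iff₀ hm', mul_comm]
      exact (hlt (φ m)).le
    exact tendsto_nhds_unique h1 h2
  obtain ⟨m, hmD, hm⟩ := hev.exists
  exact (hmin (φ m) _ hmD (by simp [hfv])).not_gt hm

end Retractable

/-! ### Intersections of two sets -/

/-- Polyhedral cones are retractable. -/
theorem IsPolyhedralCone.isRetractable {E : Type*} [NormedAddCommGroup E]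
    [InnerProductSpace ℝ E] {D : PointedCone ℝ E} (hD : IsPolyhedralCone D) :
    IsRetractable D := by
  obtain ⟨s, rfl⟩ := hD
  exact isRetractable_of_forall_nonneg (κ := s) (fun a => innerSL ℝ (a : E)) (by simp)

theorem isPolyhedralCone_top {E : Type*} [NormedAddCommGroup E] [InnerProductSpace ℝ E] :
    IsPolyhedralCone (⊤ : PointedCone ℝ E) :=
  PointedCone.DualFG.top

/-- The intersection of two sets `Kᵢ + Dᵢ` with `Kᵢ` compact and `Dᵢ` retractable is the sum of a
compact set and of the intersection of the cones. -/
theorem exists_inter_eq_add_inf {E : Type*} [NormedAddCommGroup E] [NormedSpace ℝ E]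
    [FiniteDimensional ℝ E] {K₁ K₂ : Set E} {D₁ D₂ : PointedCone ℝ E} (hK₁ : IsCompact K₁)
    (hK₂ : IsCompact K₂) (hD₁ : IsRetractable D₁) (hD₂ : IsRetractable D₂) :
    ∃ K : Set E, IsCompact K ∧
      (K₁ + (D₁ : Set E)) ∩ (K₂ + (D₂ : Set E)) = K + ((D₁ ⊓ D₂ : PointedCone ℝ E) : Set E) := by
  -- Split `x = (k₁ + p) + d` with `d` in both cones and `p` as short as possible. For long `p`, `k₁
  -- + p - k₂` has the same direction `v` as `p`, so `v` lies in both cones and part of `p` can be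
  -- moved into `d`.
  have key : ∃ C : ℝ, ∀ x ∈ (K₁ + (D₁ : Set E)) ∩ (K₂ + (D₂ : Set E)),
      ∃ k₁ ∈ K₁, ∃ k₂ ∈ K₂, ∃ p ∈ D₁, ‖p‖ ≤ C ∧ x - k₁ - p ∈ D₁ ⊓ D₂ ∧ k₁ + p - k₂ ∈ D₂ := by
    by_contra! hcon
    have hstep : ∀ m : ℕ, ∃ x, ∃ k₁ ∈ K₁, ∃ k₂ ∈ K₂, ∃ p ∈ D₁, x - k₁ - p ∈ D₁ ⊓ D₂ ∧
        k₁ + p - k₂ ∈ D₂ ∧ (m : ℝ) < ‖p‖ ∧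
        ∀ y ∈ D₁, x - k₁ - y ∈ D₁ ⊓ D₂ → k₁ + y - k₂ ∈ D₂ → ‖p‖ ≤ ‖y‖ := by
      intro m
      obtain ⟨x, ⟨⟨k₁, hk₁, d₁, hd₁, hx₁⟩, ⟨k₂, hk₂, d₂, hd₂, hx₂⟩⟩, hx⟩ := hcon m
      have hx₁ : k₁ + d₁ = x := hx₁
      have hx₂ : k₂ + d₂ = x := hx₂
      obtain ⟨p, ⟨hp, hp', hp''⟩, hmin⟩ := exists_norm_minimal
        (Z := (D₁ : Set E) ∩ ((fun p => x - k₁ - p) ⁻¹' ((D₁ ⊓ D₂ : PointedCone ℝ E) : Set E) ∩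
          (fun p => k₁ + p - k₂) ⁻¹' (D₂ : Set E)))
        (hD₁.isClosed.inter (((hD₁.inf hD₂).isClosed.preimage (by fun_prop)).inter
          (hD₂.isClosed.preimage (by fun_prop))))
        ⟨d₁, hd₁, by simp [← hx₁], by
          have : k₁ + d₁ - k₂ = d₂ := by rw [hx₁, ← hx₂]; abel
          simpa [this] using hd₂⟩
      refine ⟨x, k₁, hk₁, k₂, hk₂, p, hp, hp', hp'', ?_, fun y hy hy' hy'' =>
        hmin y ⟨hy, hy', hy''⟩⟩
      by_contra! hle
      exact hx k₁ hk₁ k₂ hk₂ p hp hle hp' hp''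
    choose x k₁ hk₁ k₂ hk₂ p hp hp' hp'' hlt hmin using hstep
    have hpos : ∀ m, 0 < ‖p m‖ := fun m => (Nat.cast_nonneg m).trans_lt (hlt m)
    obtain ⟨v, hv, -, φ, hφ, hlim, hev⟩ :=
      hD₁.exists_shorten hp (fun m => norm_pos_iff.1 (hpos m))
    have hnorm : Tendsto (fun m => ‖p (φ m)‖) atTop atTop :=
      tendsto_atTop_mono (fun m => ((Nat.cast_le.2 (hφ.id_le m)).trans (hlt (φ m)).le))
        (tendsto_natCast_atTop_atTop (R := ℝ))
    obtain ⟨C₁, hC₁⟩ := hK₁.isBounded.exists_norm_le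
    obtain ⟨C₂, hC₂⟩ := hK₂.isBounded.exists_norm_le
    have hlim' : Tendsto (fun m => ‖p (φ m)‖⁻¹ • (k₁ (φ m) + p (φ m) - k₂ (φ m))) atTop (𝓝 v) := by
      have h0 : Tendsto (fun m => ‖p (φ m)‖⁻¹ • (k₁ (φ m) - k₂ (φ m))) atTop (𝓝 0) := by
        refine (tendsto_inv_atTop_zero.comp hnorm).zero_smul_isBoundedUnder_le ?_
        exact isBoundedUnder_of ⟨C₁ + C₂, fun m => (norm_sub_le _ _).trans
          (add_le_add (hC₁ _ (hk₁ _)) (hC₂ _ (hk₂ _)))⟩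
      have := hlim.add h0
      rw [add_zero] at this
      refine this.congr fun m => ?_
      rw [← smul_add]
      congr 1
      abel
    obtain ⟨hv₂, hev₂⟩ := hD₂.of_tendsto (fun m => hp'' (φ m)) (fun m => hpos (φ m)) hlim'
    obtain ⟨m, ⟨hm, hm'⟩, hm₂⟩ := (hev.and hev₂).exists
    refine (hmin (φ m) _ hm ?_ ?_).not_gt hm'
    · have : x (φ m) - k₁ (φ m) - (p (φ m) - (‖p (φ m)‖ / 2) • v) =
        (x (φ m) - k₁ (φ m) - p (φ m)) + (‖p (φ m)‖ / 2) • v := by abel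
      rw [this]
      exact add_mem (hp' _) (PointedCone.smul_mem _ (by positivity) ⟨hv, hv₂⟩)
    · have : k₁ (φ m) + (p (φ m) - (‖p (φ m)‖ / 2) • v) - k₂ (φ m) =
        k₁ (φ m) + p (φ m) - k₂ (φ m) - (‖p (φ m)‖ / 2) • v := by abel
      rwa [this]
  obtain ⟨C, hC⟩ := key
  refine ⟨(K₁ + ((D₁ : Set E) ∩ Metric.closedBall 0 C)) ∩ (K₂ + (D₂ : Set E)), ?_, ?_⟩
  · exact (hK₁.add ((isCompact_closedBall 0 C).inter_left hD₁.isClosed)).inter_right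
      (hD₂.isClosed.add_left_of_isCompact hK₂)
  · ext x
    constructor
    · intro hx
      obtain ⟨k₁, hk₁, k₂, hk₂, p, hp, hpC, hd, hp₂⟩ := hC x hx
      refine ⟨k₁ + p, ⟨⟨k₁, hk₁, p, ⟨hp, by simpa using hpC⟩, rfl⟩,
        ⟨k₂, hk₂, _, hp₂, ?_⟩⟩, _, hd, ?_⟩
      · simp
      · simp only; abel
    · rintro ⟨_, ⟨⟨k₁, hk₁, p, ⟨hp, -⟩, rfl⟩, ⟨k₂, hk₂, q, hq, hkq⟩⟩, d, hd, rfl⟩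
      refine ⟨⟨k₁, hk₁, p + d, add_mem hp hd.1, (add_assoc _ _ _).symm⟩,
        ⟨k₂, hk₂, q + d, add_mem hq hd.2, ?_⟩⟩
      simp only at hkq ⊢
      rw [← hkq, add_assoc]

/-! ### The Frank-Wolfe theorem -/

open scoped RealInnerProductSpace in
/-- The Frank and Wolfe theorem for sums of a compact set and a retractable cone. -/
theorem exists_isMinOn_add_of_isRetractable {E : Type*} [NormedAddCommGroup E]
    [InnerProductSpace ℝ E] [FiniteDimensional ℝ E] {K : Set E} {D : PointedCone ℝ E}
    (hK : IsCompact K) (hne : K.Nonempty) (hD : IsRetractable D) (T : E →L[ℝ] E)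
    (hT : ∀ x y, ⟪T x, y⟫ = ⟪x, T y⟫) (b : E) (c : ℝ) {f : E → ℝ}
    (hf : ∀ x, f x = 1 / 2 * ⟪x, T x⟫ + ⟪b, x⟫ + c) (hbdd : BddBelow (f '' (K + (D : Set E)))) :
    ∃ x ∈ K + (D : Set E), IsMinOn f (K + (D : Set E)) x := by
  have hcont : Continuous f := by
    rw [funext hf]
    fun_prop
  have hexp : ∀ (x v : E) (t : ℝ),
      f (x + t • v) = f x + t * ⟪T x + b, v⟫ + t ^ 2 * (1 / 2 * ⟪v, T v⟫) := by
    intro x v t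
    rw [hf, hf]
    simp only [map_add, map_smul, inner_add_left, inner_add_right, inner_smul_left,
      inner_smul_right, hT]
    rw [real_inner_comm (T x) v, hT x v]
    simp
    ring
  -- Minimise over the truncations `‖d‖ ≤ N`, then choose a minimiser with `‖d‖` least.
  have hstep : ∀ N : ℕ, ∃ k ∈ K, ∃ d ∈ D, ‖d‖ ≤ N ∧
      (∀ k' ∈ K, ∀ d' ∈ D, ‖d'‖ ≤ N → f (k + d) ≤ f (k' + d')) ∧
      (∀ k' ∈ K, ∀ d' ∈ D, ‖d'‖ ≤ N → f (k' + d') ≤ f (k + d) → ‖d‖ ≤ ‖d'‖) := by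
    intro N
    have hg : Continuous fun p : E × E => f (p.1 + p.2) := by fun_prop
    have hP : IsCompact (K ×ˢ ((D : Set E) ∩ Metric.closedBall 0 N)) :=
      hK.prod ((isCompact_closedBall 0 _).inter_left hD.isClosed)
    obtain ⟨p, hp, hpmin⟩ := hP.exists_isMinOn
      (hne.prod ⟨0, D.zero_mem, by simp⟩) hg.continuousOn
    obtain ⟨q, ⟨hq, hqp⟩, hqmin⟩ := (hP.inter_right
      (isClosed_le hg (continuous_const (y := f (p.1 + p.2))))).exists_isMinOn ⟨p, hp, le_refl (f (p.1 + p.2))⟩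
      (continuous_snd.norm.continuousOn)
    have hqp : f (q.1 + q.2) ≤ f (p.1 + p.2) := hqp
    refine ⟨q.1, hq.1, q.2, hq.2.1, by simpa using hq.2.2, ?_, ?_⟩
    · intro k' hk' d' hd' hN
      exact hqp.trans (hpmin (a := (k', d')) ⟨hk', hd', by simpa using hN⟩)
    · intro k' hk' d' hd' hN hle
      exact hqmin (a := (k', d')) ⟨⟨hk', hd', by simpa using hN⟩, hle.trans hqp⟩
  choose k hk d hd hdN hmin hshort using hstep
  by_cases hcase : ∃ B : ℕ, ∃ᶠ N in atTop, ‖d N‖ ≤ B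
  · obtain ⟨B, hB⟩ := hcase
    refine ⟨k B + d B, ⟨_, hk B, _, hd B, rfl⟩, ?_⟩
    rintro _ ⟨k', hk', d', hd', rfl⟩
    obtain ⟨M, hM⟩ := exists_nat_ge ‖d'‖
    obtain ⟨N, hNM, hN⟩ := (frequently_atTop.1 hB) M
    exact (hmin B _ (hk N) _ (hd N) hN).trans
      (hmin N _ hk' _ hd' (hM.trans (Nat.cast_le.2 hNM)))
  · exfalso
    push Not at hcase
    have htop : Tendsto (fun N => ‖d N‖) atTop atTop := by
      refine tendsto_atTop.2 fun b => ?_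
      obtain ⟨B, hB⟩ := exists_nat_ge b
      exact (hcase B).mono fun N hN => hB.trans hN.le
    obtain ⟨N₀, hN₀⟩ := eventually_atTop.1 (htop.eventually_gt_atTop 0)
    obtain ⟨v, hv, -, φ, hφ, hlim, hev⟩ := hD.exists_shorten (d := fun m => d (m + N₀))
      (fun m => hd _) (fun m => norm_pos_iff.1 (hN₀ _ (Nat.le_add_left _ _)))
    set ψ : ℕ → ℕ := fun m => φ m + N₀ with hψ
    have hpos : ∀ m, 0 < ‖d (ψ m)‖ := fun m => hN₀ _ (Nat.le_add_left _ _)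
    have hψtop : Tendsto (fun m => ‖d (ψ m)‖) atTop atTop :=
      htop.comp ((tendsto_add_atTop_nat N₀).comp hφ.tendsto_atTop)
    have hinv : Tendsto (fun m => ‖d (ψ m)‖⁻¹) atTop (𝓝 0) := tendsto_inv_atTop_zero.comp hψtop
    obtain ⟨C, hC⟩ := hK.isBounded.exists_norm_le
    have hu : Tendsto (fun m => ‖d (ψ m)‖⁻¹ • (k (ψ m) + d (ψ m))) atTop (𝓝 v) := by
      have h0 : Tendsto (fun m => ‖d (ψ m)‖⁻¹ • k (ψ m)) atTop (𝓝 0) :=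
        hinv.zero_smul_isBoundedUnder_le (isBoundedUnder_of ⟨C, fun m => hC _ (hk _)⟩)
      have := h0.add hlim
      rw [zero_add] at this
      exact this.congr fun m => (smul_add _ _ _).symm
    -- Divide `f (k N + d N) ≤ f (k 0 + d 0)` by `‖d N‖ ^ 2` and pass to the limit.
    have hq : 1 / 2 * ⟪v, T v⟫ ≤ 0 := by
      have h1 := (((hu.inner ((T.continuous.tendsto v).comp hu)).const_mul (1 / 2 : ℝ)).add
        (hinv.mul ((tendsto_const_nhds (x := b)).inner hu))).add
        ((hinv.mul hinv).mul_const c)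
      have h2 := (hinv.mul hinv).mul_const (f (k 0 + d 0))
      simp only [zero_mul, add_zero] at h1 h2
      refine le_of_tendsto_of_tendsto' h1 h2 fun m => ?_
      have h3 := hmin (ψ m) _ (hk 0) _ (hd 0) ((hdN 0).trans (by simp))
      have h4 := mul_le_mul_of_nonneg_left h3
        (mul_self_nonneg (‖d (ψ m)‖⁻¹))
      refine le_trans (le_of_eq ?_) h4
      rw [hf]
      simp only [Function.comp, map_smul, inner_smul_left, inner_smul_right]
      simp
      ring
    have hgrad : ∀ x ∈ K + (D : Set E), 0 ≤ ⟪T x + b, v⟫ := by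
      rintro x ⟨k', hk', d', hd', rfl⟩
      by_contra! hneg
      obtain ⟨L, hL⟩ := hbdd
      set x := k' + d'
      set β := ⟪T x + b, v⟫
      have hLx : L ≤ f x := hL ⟨x, ⟨k', hk', d', hd', rfl⟩, rfl⟩
      -- For this `t` the linear term alone brings `f` down to `L - 1`.
      set t := (f x - L + 1) / (-β) with ht
      have ht0 : 0 ≤ t := div_nonneg (by linarith) (by linarith)
      have htβ : t * β = -(f x - L + 1) := by
        have hβ : β ≠ 0 := hneg.ne
        rw [ht]; field_simp
      have hmem : x + t • v ∈ K + (D : Set E) :=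
        ⟨k', hk', d' + t • v, add_mem hd' (D.smul_mem ht0 hv), (add_assoc _ _ _).symm⟩
      have h1 : L ≤ f (x + t • v) := hL ⟨_, hmem, rfl⟩
      rw [hexp] at h1
      have h2 : t ^ 2 * (1 / 2 * ⟪v, T v⟫) ≤ 0 := mul_nonpos_of_nonneg_of_nonpos (sq_nonneg t) hq
      have h3 : t * ⟪T x + b, v⟫ = -(f x - L + 1) := htβ
      linarith
    -- Slope along `v` is nonnegative and curvature nonpositive, so stepping back along `v` does not
    -- increase `f` but shortens `d`.
    obtain ⟨m, hmD, hm⟩ := hev.exists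
    set s := ‖d (ψ m)‖ / 2 with hs
    have hs0 : 0 < s := half_pos (hpos m)
    have hy : k (ψ m) + (d (ψ m) - s • v) = (k (ψ m) + d (ψ m)) + (-s) • v := by
      rw [neg_smul]; abel
    refine (hshort (ψ m) (k (ψ m)) (hk _) _ hmD (hm.le.trans (hdN _)) ?_).not_gt hm
    change f (k (ψ m) + (d (ψ m) - s • v)) ≤ _
    rw [hy, hexp]
    have h1 := hgrad (k (ψ m) + d (ψ m)) ⟨_, hk _, _, hd _, rfl⟩
    nlinarith [mul_nonneg hs0.le h1, sq_nonneg s, mul_nonneg (sq_nonneg s) (neg_nonneg.2 hq)]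

/-! ### Finitely generated cones -/

section FiniteGeneration

theorem fg_ofSubmodule {E : Type*} [AddCommGroup E] [Module ℝ E]
    (W : Submodule ℝ E) [FiniteDimensional ℝ W] : (PointedCone.ofSubmodule W).FG := by
  have : Module.Finite {c : ℝ // 0 ≤ c} W := inferInstance
  exact Module.Finite.iff_fg.1 this

variable {E : Type*} [NormedAddCommGroup E] [NormedSpace ℝ E]

/-- The elements of a finitely generated cone are nonnegative combinations of the generators with
coefficients bounded linearly by the norm. -/
theorem exists_bounded_coefficients {κ : Type*} [Fintype κ] (g : κ → E) :
    ∃ C : ℝ, ∀ h ∈ Submodule.span {c : ℝ // 0 ≤ c} (range g),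
      ∃ l : κ → ℝ, (∀ i, 0 ≤ l i) ∧ (∀ i, l i ≤ C * ‖h‖) ∧ h = ∑ i, l i • g i := by
  have hR : IsRetractable (PointedCone.positive ℝ (κ → ℝ)) :=
    isRetractable_of_forall_nonneg (fun i => ContinuousLinearMap.proj i) fun x => by
      simp [Pi.le_def]
  obtain ⟨C, hC⟩ := hR.exists_bounded_lift
    (∑ i, (ContinuousLinearMap.proj (R := ℝ) (φ := fun _ : κ => ℝ) i).smulRight (g i))
  refine ⟨C, fun h hh => ?_⟩
  obtain ⟨c, rfl⟩ := (Submodule.mem_span_range_iff_exists_fun _).1 hh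
  obtain ⟨l, hl, hl', hlC⟩ := hC (fun i => (c i : ℝ)) (fun i => (c i).2)
  simp only [sum_apply, ContinuousLinearMap.smulRight_apply,
    ContinuousLinearMap.proj_apply] at hl' hlC
  refine ⟨l, hl, fun i => ?_, ?_⟩
  · exact (le_abs_self _).trans ((norm_le_pi_norm l i).trans hlC)
  · exact hl'.symm

/-- Write generators of `D + ℝv` as `d i + s i • v` with `d i ∈ D`. For `x` near `v`, `x - v` has
small coefficients `l i`, so in `x - v / 2 = ∑ l i • d i + (1 / 2 + ∑ l i * s i) • v` the last
coefficient is nonnegative. -/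
theorem eventually_mem_of_fg_sup {D : PointedCone ℝ E} {v : E} (hv : v ∈ D)
    (hfg : (D ⊔ PointedCone.ofSubmodule (ℝ ∙ v)).FG) :
    ∃ C ≤ D, C.FG ∧ v ∈ C ∧ ∀ᶠ x in 𝓝 v, x ∈ D → x - (1 / 2 : ℝ) • v ∈ C := by
  obtain ⟨n, g, hg⟩ := Submodule.fg_iff_exists_fin_generating_family.1 hfg
  have hgen : ∀ i, ∃ d ∈ D, ∃ s : ℝ, d + s • v = g i := by
    intro i
    have : g i ∈ D ⊔ PointedCone.ofSubmodule (ℝ ∙ v) := hg ▸ Submodule.subset_span ⟨i, rfl⟩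
    obtain ⟨d, hd, w, hw, h⟩ := Submodule.mem_sup.1 this
    obtain ⟨s, rfl⟩ := Submodule.mem_span_singleton.1 (show w ∈ (ℝ ∙ v) from hw)
    exact ⟨d, hd, s, h⟩
  choose d hd s hds using hgen
  obtain ⟨B, hB⟩ := exists_bounded_coefficients g
  refine ⟨PointedCone.hull ℝ (insert v (range d)), ?_, ?_, ?_, ?_⟩
  · refine Submodule.span_le.2 (insert_subset hv ?_)
    rintro _ ⟨i, rfl⟩
    exact hd i
  · exact Submodule.fg_span ((finite_range d).insert v)
  · exact Submodule.subset_span (mem_insert _ _)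
  · have hlim : Tendsto (fun x => ∑ i, B * ‖x - v‖ * |s i|) (𝓝 v) (𝓝 0) := by
      have : Continuous fun x => ∑ i, B * ‖x - v‖ * |s i| := by fun_prop
      simpa using this.tendsto v
    filter_upwards [hlim.eventually (gt_mem_nhds (one_half_pos (α := ℝ)))] with x hx hxD
    have hmem : x - v ∈ Submodule.span {c : ℝ // 0 ≤ c} (range g) := by
      rw [hg, sub_eq_add_neg]
      refine add_mem (Submodule.mem_sup_left hxD) (Submodule.mem_sup_right ?_)
      exact (ℝ ∙ v).neg_mem (Submodule.mem_span_singleton_self v)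
    obtain ⟨l, hl0, hlB, hl⟩ := hB _ hmem
    have hx' : x - (1 / 2 : ℝ) • v = ∑ i, l i • d i + (1 / 2 + ∑ i, l i * s i) • v := by
      have h1 : x = v + ∑ i, l i • g i := by rw [← hl]; abel
      rw [h1]
      simp only [← hds, smul_add, Finset.sum_add_distrib, smul_smul, add_smul, Finset.sum_smul]
      module
    have hsum : |∑ i, l i * s i| ≤ ∑ i, B * ‖x - v‖ * |s i| := by
      refine (Finset.abs_sum_le_sum_abs _ _).trans (Finset.sum_le_sum fun i _ => ?_)
      rw [abs_mul, abs_of_nonneg (hl0 i)]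
      exact mul_le_mul_of_nonneg_right (hlB i) (abs_nonneg _)
    rw [hx']
    refine add_mem (sum_mem fun i _ => ?_) ?_
    · exact PointedCone.smul_mem _ (hl0 i)
        (Submodule.subset_span (mem_insert_of_mem _ (mem_range_self i)))
    · exact PointedCone.smul_mem _ (by linarith [neg_abs_le (∑ i, l i * s i)])
        (Submodule.subset_span (mem_insert _ _))

theorem isRetractable_of_fg {D : PointedCone ℝ E} (hcl : IsClosed (D : Set E))
    (hfg : D.FG) : IsRetractable D := by
  refine ⟨hcl, fun v hv => ?_⟩
  obtain ⟨C, hC, -, -, h⟩ := eventually_mem_of_fg_sup hv (hfg.sup (fg_ofSubmodule (ℝ ∙ v)))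
  exact h.mono fun x hx hxD => hC (hx hxD)

end FiniteGeneration

/-! ### Mirkil's theorem and cancellation of compact summands -/

section Closedness

open scoped RealInnerProductSpace

variable {E : Type*} [NormedAddCommGroup E] [InnerProductSpace ℝ E] [FiniteDimensional ℝ E]

/-- Locally around each unit vector of `D ∩ Wᗮ`, `D` lies in a finitely generated subcone; by
compactness finitely many suffice, and adding `W` recovers `D`. -/
theorem fg_of_forall_fg_sup {D : PointedCone ℝ E} (hD : IsClosed (D : Set E)) {W : Submodule ℝ E}
    (hW : PointedCone.ofSubmodule W ≤ D)
    (hfg : ∀ v ∈ D, v ∉ W → (D ⊔ PointedCone.ofSubmodule (ℝ ∙ v)).FG) : D.FG := by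
  have hcomp : IsCompact ((D : Set E) ∩ (Wᗮ : Set E) ∩ Metric.sphere 0 1) :=
    (isCompact_sphere 0 1).inter_left (hD.inter Wᗮ.closed_of_finiteDimensional)
  have key : ∃ C ≤ D, C.FG ∧ ∀ x ∈ (D : Set E) ∩ (Wᗮ : Set E) ∩ Metric.sphere 0 1, x ∈ C := by
    refine hcomp.induction_on (p := fun s => ∃ C ≤ D, C.FG ∧ ∀ x ∈ s, x ∈ C)
      ⟨⊥, bot_le, Submodule.fg_bot, by simp⟩ ?_ ?_ ?_
    · rintro s t hst ⟨C, hC, hC', h⟩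
      exact ⟨C, hC, hC', fun x hx => h x (hst hx)⟩
    · rintro s t ⟨C, hC, hC', h⟩ ⟨C₂, hC₂, hC₂', h₂⟩
      refine ⟨C ⊔ C₂, sup_le hC hC₂, hC'.sup hC₂', ?_⟩
      rintro x (hx | hx)
      · exact Submodule.mem_sup_left (h x hx)
      · exact Submodule.mem_sup_right (h₂ x hx)
    · rintro v ⟨⟨hvD, hvW⟩, hv1⟩
      have hvW' : v ∉ W := by
        intro h
        have h0 : v = 0 := inner_self_eq_zero.1 (hvW v h)
        simp [h0] at hv1
      obtain ⟨C, hC, hC', hvC, hev⟩ := eventually_mem_of_fg_sup hvD (hfg v hvD hvW')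
      refine ⟨{x | x ∈ D → x - (1 / 2 : ℝ) • v ∈ C} ∩ D, ?_, C, hC, hC', ?_⟩
      · refine inter_mem (mem_nhdsWithin_of_mem_nhds hev) ?_
        exact mem_of_superset self_mem_nhdsWithin fun x hx => hx.1.1
      · rintro x ⟨hx, hxD⟩
        have := add_mem (hx hxD) (C.smul_mem (by norm_num : (0 : ℝ) ≤ 1 / 2) hvC)
        simpa using this
  obtain ⟨C, hC, hCfg, hmem⟩ := key
  have hDC : D = C ⊔ PointedCone.ofSubmodule W := by
    refine le_antisymm (fun x hx => ?_) (sup_le hC hW)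
    set w := W.starProjection x
    have hw : w ∈ W := W.starProjection_apply_mem x
    have hu : x - w ∈ Wᗮ := W.sub_starProjection_mem_orthogonal x
    have huD : x - w ∈ D := by
      rw [sub_eq_add_neg]
      exact add_mem hx (hW (W.neg_mem hw))
    have huC : x - w ∈ C := by
      rcases eq_or_ne (x - w) 0 with h0 | h0
      · rw [h0]; exact C.zero_mem
      · have hp : 0 < ‖x - w‖ := norm_pos_iff.2 h0
        have h1 : ‖x - w‖⁻¹ • (x - w) ∈ C := by
          refine hmem _ ⟨⟨D.smul_mem (inv_nonneg.2 hp.le) huD, Wᗮ.smul_mem _ hu⟩, ?_⟩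
          simp [norm_smul, hp.ne']
        have h2 := C.smul_mem hp.le h1
        rwa [smul_smul, mul_inv_cancel₀ hp.ne', one_smul] at h2
    have : x = (x - w) + w := by abel
    rw [this]
    exact add_mem (Submodule.mem_sup_left huC) (Submodule.mem_sup_right hw)
  rw [hDC]
  exact hCfg.sup (fg_ofSubmodule W)

/-- Mirkil's theorem: a convex cone whose sums with all linear subspaces are closed is finitely
generated. -/
theorem fg_of_isClosed_sup {D : PointedCone ℝ E}
    (hD : ∀ W : Submodule ℝ E, IsClosed ((D ⊔ PointedCone.ofSubmodule W : PointedCone ℝ E) : Set E)) :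
    D.FG := by
  -- Induction on the codimension of `W`: adjoining `v ∉ W` lowers it.
  have key : ∀ (n : ℕ) (W : Submodule ℝ E), Module.finrank ℝ E ≤ Module.finrank ℝ W + n →
      (D ⊔ PointedCone.ofSubmodule W).FG := by
    intro n
    induction n with
    | zero =>
      intro W hW
      have : W = ⊤ := Submodule.eq_top_of_finrank_eq (le_antisymm W.finrank_le hW)
      subst this
      have h : D ⊔ PointedCone.ofSubmodule (⊤ : Submodule ℝ E) =
          PointedCone.ofSubmodule (⊤ : Submodule ℝ E) :=
        sup_eq_right.2 fun x _ => (Submodule.mem_top : x ∈ (⊤ : Submodule ℝ E))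
      rw [h]
      exact fg_ofSubmodule _
    | succ n ih =>
      intro W hW
      refine fg_of_forall_fg_sup (hD W) le_sup_right fun v _ hvW => ?_
      rw [sup_assoc, ← PointedCone.ofSubmodule_sup]
      refine ih _ ?_
      have hlt : W < W ⊔ ℝ ∙ v := by
        refine lt_of_le_of_ne le_sup_left fun h => hvW ?_
        rw [h]
        exact Submodule.mem_sup_right (Submodule.mem_span_singleton_self v)
      have := Submodule.finrank_lt_finrank_of_lt hlt
      omega
  have h := key (Module.finrank ℝ E) ⊥ (by simp)
  have hbot : D ⊔ PointedCone.ofSubmodule (⊥ : Submodule ℝ E) = D := by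
    refine sup_eq_left.2 fun x hx => ?_
    have : x = 0 := (Submodule.mem_bot ℝ).1 hx
    rw [this]
    exact D.zero_mem
  rwa [hbot] at h

/-- Since `M` need not be closed, separation may be weak; the last clause keeps it from being
trivial on both `M` and `v`. If `v ∈ span M`, thickening `M` by the orthogonal complement gives a
cone with interior. -/
theorem exists_nonneg_on_of_notMem {M : PointedCone ℝ E} {v : E} (hv : v ∉ M) :
    ∃ a : E →L[ℝ] ℝ, (∀ m ∈ M, 0 ≤ a m) ∧ a v ≤ 0 ∧ (a v < 0 ∨ ∃ m ∈ M, a m ≠ 0) := by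
  set S := Submodule.span ℝ (M : Set E) with hS
  by_cases hvS : v ∈ S
  · set N : PointedCone ℝ E := M ⊔ PointedCone.ofSubmodule Sᗮ with hN
    have hMN : M ≤ N := le_sup_left
    have hSN : PointedCone.ofSubmodule Sᗮ ≤ N := le_sup_right
    have hvN : v ∉ N := by
      intro h
      obtain ⟨m, hm, w, hw, rfl⟩ := Submodule.mem_sup.1 h
      have hw : w ∈ Sᗮ := hw
      have hwS : w ∈ S := by
        have := S.sub_mem hvS (Submodule.subset_span hm)
        simpa using this
      have h0 : w = 0 := inner_self_eq_zero.1 (hw w hwS)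
      exact hv (by simpa [h0] using hm)
    have hspan : Submodule.span ℝ (N : Set E) = ⊤ := by
      rw [eq_top_iff, ← Submodule.sup_orthogonal_of_hasOrthogonalProjection (K := S)]
      exact sup_le (Submodule.span_mono hMN) (fun x hx => Submodule.subset_span (hSN hx))
    have hint : (interior (N : Set E)).Nonempty := by
      rw [N.convex.interior_nonempty_iff_affineSpan_eq_top,
        AffineSubspace.affineSpan_eq_top_iff_vectorSpan_eq_top_of_nonempty ℝ E E
          ⟨0, N.zero_mem⟩, vectorSpan_eq_span_vsub_set_right ℝ (show (0 : E) ∈ (N : Set E) from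
          N.zero_mem)]
      simpa using hspan
    obtain ⟨a, ha⟩ := geometric_hahn_banach_point_open N.convex.interior isOpen_interior
      (fun h => hvN (interior_subset h))
    have hle : ∀ x ∈ N, a v ≤ a x := by
      intro x hx
      have hx' : x ∈ closure (interior (N : Set E)) := by
        rw [N.convex.closure_interior_eq_closure_of_nonempty_interior hint]
        exact subset_closure hx
      exact closure_minimal (fun y hy => (ha y hy).le)
        (isClosed_le continuous_const a.continuous) hx'
    have hnn : ∀ x ∈ N, 0 ≤ a x := by
      intro x hx
      by_contra! hneg
      have ht : 0 ≤ (|a v| + 1) / (-a x) := div_nonneg (by positivity) (by linarith)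
      have h1 := hle _ (N.smul_mem ht hx)
      have h2 : (|a v| + 1) / (-a x) * a x = -(|a v| + 1) := by
        have := hneg.ne
        field_simp
      rw [map_smul, smul_eq_mul, h2] at h1
      linarith [neg_abs_le (a v)]
    refine ⟨a, fun m hm => hnn m (hMN hm), by simpa using hle 0 N.zero_mem, ?_⟩
    -- Were `a` zero on `M` and at `v`, an interior point `m + w` would give `a w > 0`, whereas `-w
    -- ∈ N` gives `a w ≤ 0`.
    by_contra! hcon
    obtain ⟨hav, ham⟩ := hcon
    obtain ⟨x, hx⟩ := hint
    have hker : S ≤ LinearMap.ker (a : E →ₗ[ℝ] ℝ) := Submodule.span_le.2 fun m hm => ham m hm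
    obtain ⟨m, hm, w, hw, rfl⟩ := Submodule.mem_sup.1 (interior_subset hx)
    have h1 := ha _ hx
    have h2 : a v = 0 := hker hvS
    have h3 : 0 ≤ a (-w) := hnn _ (hSN (Sᗮ.neg_mem hw))
    rw [map_add, ham m hm, h2] at h1
    rw [map_neg] at h3
    linarith
  · set u := v - S.starProjection v with hu
    have huS : u ∈ Sᗮ := S.sub_starProjection_mem_orthogonal v
    have hu0 : u ≠ 0 := fun h => hvS (by
      have h' : v = S.starProjection v := sub_eq_zero.1 h
      rw [h']
      exact S.starProjection_apply_mem v)
    have huv : ⟪u, v⟫ = ⟪u, u⟫ := by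
      have h0 : ⟪u, S.starProjection v⟫ = 0 :=
        Submodule.inner_left_of_mem_orthogonal (S.starProjection_apply_mem v) huS
      conv_rhs => rw [hu, inner_sub_right, ← hu, h0, sub_zero]
    have hneg : -⟪u, v⟫ < 0 := by
      rw [huv]
      exact neg_neg_of_pos (real_inner_self_pos.2 hu0)
    refine ⟨-innerSL ℝ u, fun m hm => ?_, by simpa using hneg.le, Or.inl (by simpa using hneg)⟩
    have : ⟪u, m⟫ = 0 :=
      Submodule.inner_left_of_mem_orthogonal (Submodule.subset_span hm) huS
    simp [this]

/-- If `v ∉ M`, separate by `a`. Where `a` is minimal on `K`, `k + v = k₁ + m` forces `k₁` minimal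
and `a m = a v = 0`. The hypothesis thus passes to that face of `K` and to `M ∩ ker a`, whose span
is smaller. -/
theorem mem_of_forall_add_mem_add {M : PointedCone ℝ E} {K : Set E} {v : E} (hK : IsCompact K)
    (hne : K.Nonempty) (h : ∀ k ∈ K, k + v ∈ K + (M : Set E)) : v ∈ M := by
  induction hn : Module.finrank ℝ (Submodule.span ℝ (M : Set E)) using Nat.strong_induction_on
    generalizing M K with
  | _ n ih =>
    by_contra hv
    obtain ⟨a, haM, hav, ha⟩ := exists_nonneg_on_of_notMem hv
    obtain ⟨k₀, hk₀, hmin⟩ := hK.exists_isMinOn hne a.continuous.continuousOn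
    have hface : ∀ k ∈ K, a k = a k₀ → ∃ k₁ ∈ K, ∃ m ∈ M, k₁ + m = k + v ∧ a k₁ = a k₀ ∧
        a m = 0 ∧ a v = 0 := by
      intro k hk hak
      obtain ⟨k₁, hk₁, m, hm, hkm⟩ := h k hk
      have hkm : k₁ + m = k + v := hkm
      have h1 : a k₁ + a m = a k + a v := by rw [← map_add, hkm, map_add]
      have h2 : a k₀ ≤ a k₁ := hmin hk₁
      have h3 := haM m hm
      exact ⟨k₁, hk₁, m, hm, hkm, by linarith, by linarith, by linarith⟩
    obtain ⟨-, -, -, -, -, -, -, hav0⟩ := hface k₀ hk₀ rfl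
    obtain ⟨m₀, hm₀, ham₀⟩ := ha.resolve_left (by simp [hav0])
    set M' : PointedCone ℝ E :=
      M ⊓ PointedCone.ofSubmodule (LinearMap.ker (a : E →ₗ[ℝ] ℝ)) with hM'
    have hlt : Submodule.span ℝ (M' : Set E) < Submodule.span ℝ (M : Set E) := by
      refine lt_of_le_of_ne (Submodule.span_mono inter_subset_left) fun heq => ham₀ ?_
      have h1 : Submodule.span ℝ (M' : Set E) ≤ LinearMap.ker (a : E →ₗ[ℝ] ℝ) :=
        Submodule.span_le.2 inter_subset_right
      exact h1 (heq ▸ Submodule.subset_span hm₀)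
    refine hv (ih _ (hn ▸ Submodule.finrank_lt_finrank_of_lt hlt) (M := M')
      (K := K ∩ {k | a k = a k₀}) (hK.inter_right (isClosed_eq a.continuous continuous_const))
      ⟨k₀, hk₀, rfl⟩ ?_ rfl).1
    rintro k ⟨hk, hak⟩
    obtain ⟨k₁, hk₁, m, hm, hkm, hak₁, ham, -⟩ := hface k hk hak
    exact ⟨k₁, ⟨hk₁, hak₁⟩, m, ⟨hm, ham⟩, hkm⟩

/-- A convex cone is closed as soon as its sum with some nonempty compact set is closed. -/
theorem isClosed_of_isClosed_add {M : PointedCone ℝ E} {K : Set E} (hK : IsCompact K)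
    (hne : K.Nonempty) (h : IsClosed (K + (M : Set E))) : IsClosed (M : Set E) := by
  refine isClosed_of_closure_subset fun v hv => mem_of_forall_add_mem_add hK hne fun k hk => ?_
  have : MapsTo (fun x => k + x) (M : Set E) (K + (M : Set E)) := fun m hm => ⟨k, hk, m, hm, rfl⟩
  exact h.closure_eq ▸ this.closure (by fun_prop) hv

end Closedness

/-! ### Quadratic functions and cones of FW-sets -/

section Quadratic

open scoped RealInnerProductSpace

theorem isQuadratic_iff {n : ℕ} {f : EuclideanSpace ℝ (Fin n) → ℝ} :
    IsQuadratic f ↔ ∃ (T : EuclideanSpace ℝ (Fin n) →L[ℝ] EuclideanSpace ℝ (Fin n))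
      (b : EuclideanSpace ℝ (Fin n)) (c : ℝ), IsSelfAdjoint T ∧
        ∀ x, f x = 1 / 2 * ⟪x, T x⟫ + ⟪b, x⟫ + c := by
  have hform : ∀ (A : Matrix (Fin n) (Fin n) ℝ) (x : EuclideanSpace ℝ (Fin n)),
      ⟪x, Matrix.toEuclideanCLM (𝕜 := ℝ) A x⟫ = x.ofLp ⬝ᵥ A.mulVec x.ofLp := by
    intro A x
    rw [EuclideanSpace.inner_eq_star_dotProduct, dotProduct_comm]
    simp
  have hlin : ∀ b x : EuclideanSpace ℝ (Fin n), ⟪b, x⟫ = b.ofLp ⬝ᵥ x.ofLp := by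
    intro b x
    rw [EuclideanSpace.inner_eq_star_dotProduct, dotProduct_comm]
    simp
  have hsymm : ∀ A : Matrix (Fin n) (Fin n) ℝ,
      A.IsSymm ↔ IsSelfAdjoint (Matrix.toEuclideanCLM (𝕜 := ℝ) A) := by
    intro A
    rw [IsSelfAdjoint, ← map_star, EmbeddingLike.apply_eq_iff_eq, Matrix.star_eq_conjTranspose,
      Matrix.conjTranspose_eq_transpose_of_trivial, Matrix.IsSymm]
  constructor
  · rintro ⟨A, b, c, hA, hf⟩
    refine ⟨Matrix.toEuclideanCLM (𝕜 := ℝ) A, WithLp.toLp 2 b, c, (hsymm A).1 hA, fun x => ?_⟩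
    rw [hf, hform, hlin]
  · rintro ⟨T, b, c, hT, hf⟩
    refine ⟨(Matrix.toEuclideanCLM (n := Fin n) (𝕜 := ℝ)).symm T, b.ofLp, c, ?_, fun x => ?_⟩
    · rw [hsymm]
      simpa using hT
    · rw [hf, ← hform, ← hlin, StarAlgEquiv.apply_symm_apply]

theorem isQuadratic_norm_starProjection_sub_sq {n : ℕ}
    (W : Submodule ℝ (EuclideanSpace ℝ (Fin n))) (y : EuclideanSpace ℝ (Fin n)) :
    IsQuadratic fun x => ‖W.starProjection (x - y)‖ ^ 2 := by
  have hP : ∀ u v, ⟪W.starProjection u, W.starProjection v⟫ = ⟪u, W.starProjection v⟫ := by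
    intro u v
    rw [Submodule.inner_starProjection_left_eq_right,
      Submodule.starProjection_eq_self_iff.2 (W.starProjection_apply_mem v)]
  refine isQuadratic_iff.2 ⟨W.starProjection + W.starProjection, -(2 : ℝ) • W.starProjection y,
    ⟪y, W.starProjection y⟫, ?_, fun x => ?_⟩
  · exact (isSelfAdjoint_starProjection W).add (isSelfAdjoint_starProjection W)
  · rw [← real_inner_self_eq_norm_sq, hP]
    simp only [map_sub, inner_sub_left, inner_sub_right, add_apply, inner_add_right,
      inner_smul_left]
    rw [real_inner_comm (W.starProjection y) x,
      Submodule.inner_starProjection_left_eq_right W y x]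
    simp
    ring

end Quadratic

/-- The squared distance to `y + W` is quadratic. For `y` in the closure of `F + W` its infimum on
`F` is zero, and attaining it puts `y` in `F + W`. -/
theorem IsFW.isClosed_add_submodule {n : ℕ} {F : Set (EuclideanSpace ℝ (Fin n))} (hF : IsFW F)
    (W : Submodule ℝ (EuclideanSpace ℝ (Fin n))) :
    IsClosed (F + (W : Set (EuclideanSpace ℝ (Fin n)))) := by
  refine isClosed_of_closure_subset fun y hy => ?_
  obtain ⟨x₀, hx₀, hmin⟩ := hF _ (isQuadratic_norm_starProjection_sub_sq Wᗮ y)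
    ⟨0, by rintro _ ⟨x, -, rfl⟩; exact sq_nonneg _⟩
  have hle : ∀ z ∈ F + (W : Set (EuclideanSpace ℝ (Fin n))),
      ‖Wᗮ.starProjection (x₀ - y)‖ ^ 2 ≤ ‖Wᗮ.starProjection (z - y)‖ ^ 2 := by
    rintro _ ⟨x, hx, w, hw, rfl⟩
    have h0 : Wᗮ.starProjection w = 0 :=
      (Submodule.starProjection_apply_eq_zero_iff _).2 (W.le_orthogonal_orthogonal hw)
    have : Wᗮ.starProjection (x + w - y) = Wᗮ.starProjection (x - y) := by
      rw [add_sub_right_comm, map_add, h0, add_zero]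
    rw [this]
    exact hmin hx
  have hclosed : IsClosed {z : EuclideanSpace ℝ (Fin n) |
      ‖Wᗮ.starProjection (x₀ - y)‖ ^ 2 ≤ ‖Wᗮ.starProjection (z - y)‖ ^ 2} :=
    isClosed_le (by fun_prop) (by fun_prop)
  have hcl : ‖Wᗮ.starProjection (x₀ - y)‖ ^ 2 ≤ ‖Wᗮ.starProjection (y - y)‖ ^ 2 :=
    closure_minimal hle hclosed hy
  have hzero : Wᗮ.starProjection (x₀ - y) = 0 := by
    rw [sub_self, map_zero, norm_zero, zero_pow two_ne_zero] at hcl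
    exact norm_eq_zero.1 (pow_eq_zero_iff two_ne_zero |>.1 (le_antisymm hcl (sq_nonneg _)))
  have hW : x₀ - y ∈ W := by
    have := (Submodule.starProjection_apply_eq_zero_iff _).1 hzero
    rwa [Submodule.orthogonal_orthogonal] at this
  refine ⟨x₀, hx₀, y - x₀, ?_, by simp⟩
  rw [← neg_sub]
  exact W.neg_mem hW

/-- In a Motzkin decomposition of a nonempty Frank-and-Wolfe set the cone is retractable. -/
theorem IsFW.isRetractable {n : ℕ} {K : Set (EuclideanSpace ℝ (Fin n))}
    {D : PointedCone ℝ (EuclideanSpace ℝ (Fin n))} (hK : IsCompact K) (hne : K.Nonempty)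
    (hD : IsClosed (D : Set (EuclideanSpace ℝ (Fin n))))
    (hF : IsFW (K + (D : Set (EuclideanSpace ℝ (Fin n))))) : IsRetractable D := by
  refine isRetractable_of_fg hD (fg_of_isClosed_sup fun W => isClosed_of_isClosed_add hK hne ?_)
  rw [Submodule.coe_sup, ← add_assoc]
  exact hF.isClosed_add_submodule W

/-! ### Finite families and conclusion -/

/-- The predicate `P` serves both parts: polyhedral cones in (a), retractable ones in (b). -/
theorem exists_iInter_eq_add {E : Type*} [NormedAddCommGroup E] [NormedSpace ℝ E]
    [FiniteDimensional ℝ E] {ι : Type*} [Finite ι] {F : ι → Set E} (P : PointedCone ℝ E → Prop)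
    (hP : ∀ D, P D → IsRetractable D) (htop : P ⊤) (hinf : ∀ D₁ D₂, P D₁ → P D₂ → P (D₁ ⊓ D₂))
    (hF : ∀ i, ∃ (K : Set E) (D : PointedCone ℝ E), IsCompact K ∧ P D ∧ F i = K + (D : Set E)) :
    ∃ (K : Set E) (D : PointedCone ℝ E), IsCompact K ∧ P D ∧ ⋂ i, F i = K + (D : Set E) := by
  classical
  have := Fintype.ofFinite ι
  have key : ∀ s : Finset ι, ∃ (K : Set E) (D : PointedCone ℝ E),
      IsCompact K ∧ P D ∧ ⋂ i ∈ s, F i = K + (D : Set E) := by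
    intro s
    induction s using Finset.induction_on with
    | empty => exact ⟨{0}, ⊤, isCompact_singleton, htop, by simp⟩
    | insert i s _ ih =>
      obtain ⟨K₁, D₁, hK₁, hD₁, h₁⟩ := hF i
      obtain ⟨K₂, D₂, hK₂, hD₂, h₂⟩ := ih
      obtain ⟨K, hK, h⟩ := exists_inter_eq_add_inf hK₁ hK₂ (hP _ hD₁) (hP _ hD₂)
      exact ⟨K, D₁ ⊓ D₂, hK, hinf _ _ hD₁ hD₂, by rw [Finset.set_biInter_insert, h₁, h₂, h]⟩
  simpa using key Finset.univ

end FrankWolfe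

open FrankWolfe in
theorem mainTheorem6 (n : ℕ) {ι : Type*} [Finite ι] (F : ι → Set (EuclideanSpace ℝ (Fin n))) :
    ((∀ i, FrankWolfe.IsCompactAddPolyhedralCone (F i)) →
      FrankWolfe.IsCompactAddPolyhedralCone (⋂ i, F i)) ∧
    ((∀ i, FrankWolfe.IsFWM (F i)) → (⋂ i, F i).Nonempty →
      FrankWolfe.IsFWM (⋂ i, F i)) := by
  refine ⟨fun hF => ?_, fun hF hne => ?_⟩
  · exact exists_iInter_eq_add IsPolyhedralCone (fun _ h => h.isRetractable)
      isPolyhedralCone_top (fun _ _ h₁ h₂ => h₁.inf h₂) hF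
  · obtain ⟨K, D, hK, hD, h⟩ := exists_iInter_eq_add IsRetractable (fun _ h => h)
      IsRetractable.top (fun _ _ h₁ h₂ => h₁.inf h₂) fun i => by
        obtain ⟨⟨-, K, D, hK, hD, h⟩, hFW⟩ := hF i
        have hKne : K.Nonempty := by
          have : (F i).Nonempty := hne.mono (Set.iInter_subset _ i)
          rw [h] at this
          exact this.of_add_left
        exact ⟨K, D, hK, IsFW.isRetractable hK hKne hD (h ▸ hFW), h⟩
    have hKne : K.Nonempty := by
      rw [h] at hne
      exact hne.of_add_left
    rw [h]
    refine ⟨⟨hD.isClosed.add_left_of_isCompact hK, K, D, hK, hD.isClosed, rfl⟩, ?_⟩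
    intro f hf hbdd
    obtain ⟨T, b, c, hT, hf⟩ := isQuadratic_iff.1 hf
    exact exists_isMinOn_add_of_isRetractable hK hKne hD T
      (ContinuousLinearMap.isSelfAdjoint_iff_isSymmetric.1 hT) b c hf hbdd
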